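/- **Theorem 3 (Power-law Concentration).** Let $\lambda>0$, let $Q=(Q_j)_{j\ge1}$ be a probability measure on $\{1,2,\ldots\}$, and let $Z$ have the compound Poisson distribution $\mathrm{CP}(\lambda,Q)$, that is, the law of $\sum_{i=1}^W X_i$ where $W\sim\mathrm{Poisson}(\lambda)$ and the $X_i$ are independent with law $Q$ and independent of $W$. Assume that $$L=\sup\Big\{\tau\ge 1:\ \sum_{j\ge1}j^\tau Q_j<\infty\Big\}>1\qquad(L=\infty\text{ is allowed}),$$ and write $q_1=\sum_{j\ge1}jQ_j$, which is finite. Let $f:\{0,1,2,\ldots\}\to\mathbb R$ be $K$-Lipschitz, i.e. $|f(j+1)-f(j)|\le K$ for all $j\ge0$. Then $f(Z)$ is integrable. Let $t>0$ and $\epsilon>0$, and put $$T=2|f(0)|+2K\lambda q_1+\epsilon,\qquad C_{j,\epsilon}=1+\frac{jK}{\epsilon},\qquad I_\epsilon(\alpha)=\lambda\sum_{j\ge1}Q_j\big\{C_{j,\epsilon}^{\alpha}-1-\alpha\log C_{j,\epsilon}\big\}\quad(0<\alpha<L),$$ where the series converges. (i) With $\exp\{-\infty\}=0$, $$\Pr\{|f(Z)-Ef(Z)|>t\}\le\exp\Big\{\inf_{0<\alpha<L}\big[I_\epsilon(\alpha)+\alpha\log(T/t)\big]\Big\}.$$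 (ii) The upper bound in (i) is less than $1$ if and only if $t>T$. On $(0,L)$ the function $I_\epsilon$ is differentiable with derivative $$i_\epsilon(\alpha):=I_\epsilon'(\alpha)=\lambda\sum_{j\ge1}Q_j\big[C_{j,\epsilon}^{\alpha}-1\big]\log C_{j,\epsilon},$$ where the series converges. Let $i_\epsilon^{-1}(s)=\sup\{\alpha\in(0,L): i_\epsilon(\alpha)\le s\}\in[0,\infty]$ for $s>0$; if $K>0$, then $i_\epsilon^{-1}(i_\epsilon(\alpha))=\alpha$ for all $0<\alpha<L$, so this is the ordinary inverse on the range of $i_\epsilon$. If $t>T$, then the upper bound in (i) equals $$\exp\Big\{-\int_0^{\log(t/T)}i_\epsilon^{-1}(s)\,ds\Big\},$$ and in particular $\Pr\{|f(Z)-Ef(Z)|>t\}$ is at most this quantity. -/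

import Mathlib

open MeasureTheory ProbabilityTheory
open scoped NNReal ENNReal

noncomputable section

/-- The compound Poisson distribution `CP(lam, Q)`: the law of the random sum `X_1 + ⋯ + X_W`,
where `W` is Poisson with mean `lam`, and the `X_i` are i.i.d. with law `Q` and independent
of `W`. -/
def compoundPoisson (lam : ℝ≥0) (Q : Measure ℕ) [IsProbabilityMeasure Q] : Measure ℕ :=
  ((poissonMeasure lam).prod (Measure.infinitePi fun _ : ℕ => Q)).map
    fun p => ∑ i ∈ Finset.range p.1, p.2 i

/-- `L = sup {τ ≥ 1 : ∑_j j ^ τ Q_j < ∞}`, possibly infinite. -/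
def momentOrder (Q : Measure ℕ) : ℝ≥0∞ :=
  ⨆ (τ : ℝ) (_ : 1 ≤ τ ∧ Summable fun j : ℕ => (j : ℝ) ^ τ * Q.real {j}), ENNReal.ofReal τ

/-- The first moment `q_1 = ∑_j j Q_j`. -/
def firstMoment (Q : Measure ℕ) : ℝ := ∑' j : ℕ, (j : ℝ) * Q.real {j}

/-- `f` is `K`-Lipschitz on `ℤ_+`. -/
def IsLipschitzNat (K : ℝ) (f : ℕ → ℝ) : Prop := ∀ j : ℕ, |f (j + 1) - f j| ≤ K

/-- `C_{j,ε} = 1 + j K / ε`. -/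
def coeffC (K ε : ℝ) (j : ℕ) : ℝ := 1 + j * K / ε

/-- The `j`-th term `Q_j (C_{j,ε} ^ α - 1 - α log C_{j,ε})` of the series in `I_ε(α)`. -/
def rateTerm (Q : Measure ℕ) (K ε α : ℝ) (j : ℕ) : ℝ :=
  Q.real {j} * (coeffC K ε j ^ α - 1 - α * Real.log (coeffC K ε j))

/-- `I_ε(α) = lam ∑_j Q_j (C_{j,ε} ^ α - 1 - α log C_{j,ε})`. -/
def rateI (lam : ℝ≥0) (Q : Measure ℕ) (K ε α : ℝ) : ℝ := lam * ∑' j : ℕ, rateTerm Q K ε α j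

/-- The `j`-th term `Q_j (C_{j,ε} ^ α - 1) log C_{j,ε}` of the series in `i_ε(α)`. -/
def rateDerivTerm (Q : Measure ℕ) (K ε α : ℝ) (j : ℕ) : ℝ :=
  Q.real {j} * ((coeffC K ε j ^ α - 1) * Real.log (coeffC K ε j))

/-- `i_ε(α) = lam ∑_j Q_j (C_{j,ε} ^ α - 1) log C_{j,ε}`. -/
def rateDeriv (lam : ℝ≥0) (Q : Measure ℕ) (K ε α : ℝ) : ℝ :=
  lam * ∑' j : ℕ, rateDerivTerm Q K ε α j

/-- The inverse of the nondecreasing function `i_ε` on `(0, L)`: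
`i_ε⁻¹(s) = sup {α ∈ (0, L) : i_ε(α) ≤ s}`.  Where `i_ε` is strictly increasing this is the
ordinary inverse on the range of `i_ε`; it is `L` at every `s` above that range. -/
def rateDerivInv (lam : ℝ≥0) (Q : Measure ℕ) (K ε s : ℝ) : ℝ≥0∞ :=
  ⨆ (α : ℝ) (_ : 0 < α ∧ ENNReal.ofReal α < momentOrder Q ∧ rateDeriv lam Q K ε α ≤ s),
    ENNReal.ofReal α

/-- `T = 2 |f(0)| + 2 K lam q_1 + ε`, where `f0 = f(0)`. -/
def threshold (lam : ℝ≥0) (Q : Measure ℕ) (K ε f0 : ℝ) : ℝ :=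
  2 * |f0| + 2 * K * lam * firstMoment Q + ε

/-- The bound `exp {inf_{0 < α < L} [I_ε(α) + α log (T / t)]}`.  The infimum is taken in the
extended reals, because it is `-∞` (and the bound is `0`) when `K = 0`, `L = ∞` and `t > T`. -/
def powerBound (lam : ℝ≥0) (Q : Measure ℕ) (K ε f0 t : ℝ) : ℝ≥0∞ :=
  EReal.exp (⨅ (α : ℝ) (_ : 0 < α ∧ ENNReal.ofReal α < momentOrder Q),
    ((rateI lam Q K ε α + α * Real.log (threshold lam Q K ε f0 / t) : ℝ) : EReal))

/-- The bound `exp {- ∫_0^{log (t / T)} i_ε⁻¹(s) ds}`, for `t > T`. -/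
def integralBound (lam : ℝ≥0) (Q : Measure ℕ) (K ε f0 t : ℝ) : ℝ≥0∞ :=
  EReal.exp (-((∫⁻ s in Set.Ioc 0 (Real.log (t / threshold lam Q K ε f0)),
    rateDerivInv lam Q K ε s : ℝ≥0∞) : EReal))

end

/-!
A compound Poisson law is infinitely divisible: `CP(λ, Q)` is the `n`-fold convolution power of
`CP(λ/n, Q)`. If `|h (x + y) - h x| ≤ c y`, then the inequality
`e ^ u ≤ 1 + u + (e ^ c - 1 - c)` for `|u| ≤ c` bounds the exponential moment of `h` under any
law `μ` by `exp (∫ h ∂μ + ∫ (e ^ c - 1 - c) ∂μ)`. Bounds of this shape tensorize under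
convolution, and `∫ (e ^ c - 1 - c) ∂CP(λ/n, Q)` is at most `(λ/n) ∫ (e ^ c - 1 - c) ∂Q` up to
`o(1/n)`, so for `CP(λ, Q)` the correction improves to `λ ∫ (e ^ c - 1 - c) ∂Q`. The power law is
Chernoff's bound for `h = α log (|f - E f| + ε)`, whose increments are at most `α log C_{j,ε}` and
whose mean is at most `α log T` by Jensen's inequality; the correction is then `I_ε(α)`.

The integral form is Legendre duality: `sup_α (α s₀ - I_ε(α))` is the area `∫ (s₀ - i_ε(α))⁺ dα`
between the level `s₀ = log (t / T)` and the graph of `i_ε`, which read horizontally is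
`∫_0^{s₀} i_ε⁻¹(s) ds`.
-/

theorem exp_sub_one_sub_le {d c : ℝ} (h : |d| ≤ c) :
    Real.exp d - 1 - d ≤ Real.exp c - 1 - c := by
  have hmono : ∀ {u v : ℝ}, 0 ≤ u → u ≤ v → Real.exp u - u ≤ Real.exp v - v := by
    intro u v hu huv
    have hv : Real.exp v = Real.exp u * Real.exp (v - u) := by
      rw [← Real.exp_add, add_sub_cancel]
    nlinarith [Real.one_le_exp hu, Real.add_one_le_exp (v - u)]
  have habs : Real.exp d - d ≤ Real.exp |d| - |d| := by
    rcases le_total 0 d with hd | hd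
    · rw [abs_of_nonneg hd]
    · have hsinh := Real.self_le_sinh_iff.2 (neg_nonneg.2 hd)
      rw [Real.sinh_eq, neg_neg] at hsinh
      rw [abs_of_nonpos hd]
      linarith
  linarith [hmono (abs_nonneg d) h]

theorem exp_sub_one_sub_nonneg (x : ℝ) : 0 ≤ Real.exp x - 1 - x := by
  linarith [Real.add_one_le_exp x]

theorem integrable_of_integrable_exp_abs {α : Type*} [MeasurableSpace α] {μ : Measure α} {X : α → ℝ}
    (hX : AEStronglyMeasurable X μ) (hexp : Integrable (fun x => Real.exp |X x|) μ) :
    Integrable X μ :=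
  hexp.mono' hX (.of_forall fun x => (lt_add_one _).le.trans (Real.add_one_le_exp |X x|))

theorem integral_exp_le_of_abs_sub_le {α : Type*} [MeasurableSpace α] {μ : Measure α}
    [IsProbabilityMeasure μ] {X c : α → ℝ} {a : ℝ} (hX : AEStronglyMeasurable X μ)
    (hc : AEStronglyMeasurable c μ) (hexp : Integrable (fun x => Real.exp (c x)) μ)
    (hXc : ∀ x, |X x - a| ≤ c x) :
    ∫ x, Real.exp (X x) ∂μ ≤
      Real.exp (∫ x, X x ∂μ + ∫ x, (Real.exp (c x) - 1 - c x) ∂μ) := by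
  have hci : Integrable c μ := integrable_of_integrable_exp_abs hc <| by
    simpa only [abs_of_nonneg ((abs_nonneg _).trans (hXc _))] using hexp
  have hdi : Integrable (fun x => X x - a) μ :=
    hci.mono' (hX.sub aestronglyMeasurable_const) (.of_forall hXc)
  have hri : Integrable (fun x => Real.exp (c x) - 1 - c x) μ :=
    (hexp.sub (integrable_const 1)).sub hci
  have hmean : ∫ x, X x ∂μ = a + ∫ x, (X x - a) ∂μ := by
    simpa using integral_add (integrable_const a) hdi
  calc ∫ x, Real.exp (X x) ∂μ = Real.exp a * ∫ x, Real.exp (X x - a) ∂μ := by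
        rw [← integral_const_mul]
        simp only [← Real.exp_add, add_sub_cancel]
    _ ≤ Real.exp a * ∫ x, (1 + (X x - a) + (Real.exp (c x) - 1 - c x)) ∂μ := by
        refine mul_le_mul_of_nonneg_left (integral_mono_of_nonneg
          (.of_forall fun x => (Real.exp_pos _).le) (((integrable_const 1).add hdi).add hri)
          (.of_forall fun x => ?_)) (Real.exp_pos a).le
        dsimp only
        linarith [exp_sub_one_sub_le (hXc x)]
    _ = Real.exp a *
          (1 + (∫ x, (X x - a) ∂μ + ∫ x, (Real.exp (c x) - 1 - c x) ∂μ)) := by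
        rw [integral_add (f := fun x => 1 + (X x - a)) ((integrable_const 1).add hdi) hri,
          integral_add (integrable_const 1) hdi]
        simp [add_assoc]
    _ ≤ Real.exp a *
          Real.exp (∫ x, (X x - a) ∂μ + ∫ x, (Real.exp (c x) - 1 - c x) ∂μ) := by
        gcongr
        linarith [Real.add_one_le_exp
          (∫ x, (X x - a) ∂μ + ∫ x, (Real.exp (c x) - 1 - c x) ∂μ)]
    _ = _ := by rw [← Real.exp_add, ← add_assoc, ← hmean]

section Increments

variable {M : Type*} [AddCommMonoid M]

/-- `h` changes by at most `c y` under translation by `y`: the regularity that a Lipschitz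
condition becomes on a discrete monoid, in the form that passes to convolutions. -/
def HasIncrementBound (c h : M → ℝ) : Prop := ∀ x y, |h (x + y) - h x| ≤ c y

theorem HasIncrementBound.abs_sub_zero_le {c h : M → ℝ} (hh : HasIncrementBound c h) (x : M) :
    |h x - h 0| ≤ c x := by
  simpa using hh 0 x

theorem HasIncrementBound.abs {c h : M → ℝ} (hh : HasIncrementBound c h) :
    HasIncrementBound c fun x => |h x| := fun x y =>
  (abs_abs_sub_abs_le _ _).trans (hh x y)

theorem HasIncrementBound.translate {c h : M → ℝ} (hh : HasIncrementBound c h) (x : M) :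
    HasIncrementBound c fun y => h (x + y) := fun y z => by
  simpa only [add_assoc] using hh (x + y) z

variable [Countable M] [MeasurableSpace M] [DiscreteMeasurableSpace M]

/-- The modified exponential moment inequality `∫ e ^ h ≤ exp (∫ h + R)` for all functions whose
increments are controlled by `c`. The error `R` is additive under convolution. -/
def HasExpMomentBound (μ : Measure M) (c : M → ℝ) (R : ℝ) : Prop :=
  ∀ h, HasIncrementBound c h → ∫ x, Real.exp (h x) ∂μ ≤ Real.exp (∫ x, h x ∂μ + R)

variable {μ ν : Measure M} {c h : M → ℝ}

theorem hasExpMomentBound_integral [IsProbabilityMeasure μ]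
    (hc : Integrable (fun x => Real.exp (c x)) μ) :
    HasExpMomentBound μ c (∫ x, (Real.exp (c x) - 1 - c x) ∂μ) := fun _ hh =>
  integral_exp_le_of_abs_sub_le .of_discrete .of_discrete hc hh.abs_sub_zero_le

theorem HasIncrementBound.integrable_exp (hc : Integrable (fun x => Real.exp (c x)) μ)
    (hh : HasIncrementBound c h) : Integrable (fun x => Real.exp (h x)) μ := by
  refine (hc.const_mul (Real.exp (h 0))).mono' .of_discrete (.of_forall fun x => ?_)
  rw [Real.norm_of_nonneg (Real.exp_pos _).le, ← Real.exp_add, Real.exp_le_exp]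
  linarith [le_of_abs_le (hh.abs_sub_zero_le x)]

theorem HasIncrementBound.integrable (hc : Integrable (fun x => Real.exp (c x)) μ)
    (hh : HasIncrementBound c h) : Integrable h μ :=
  integrable_of_integrable_exp_abs .of_discrete (hh.abs.integrable_exp hc)

theorem HasIncrementBound.integral_translate [IsProbabilityMeasure ν]
    (hc : Integrable (fun x => Real.exp (c x)) ν)
    (hh : HasIncrementBound c h) :
    HasIncrementBound c fun x => ∫ y, h (x + y) ∂ν := fun x z => by
  rw [← integral_sub ((hh.translate _).integrable hc) ((hh.translate _).integrable hc)]
  simpa using norm_integral_le_of_norm_le_const (μ := ν) (C := c z)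
    (f := fun y => h (x + z + y) - h (x + y))
    (.of_forall fun y => by
      simpa only [Real.norm_eq_abs, add_right_comm x y z] using hh (x + y) z)

theorem HasIncrementBound.integrable_exp_conv
    (hμ : Integrable (fun x => Real.exp (c x)) μ)
    (hν : Integrable (fun x => Real.exp (c x)) ν) (hh : HasIncrementBound c h) :
    Integrable (fun x => Real.exp (h x)) (μ ∗ ν) := by
  rw [Measure.conv, integrable_map_measure .of_discrete .of_discrete]
  refine ((hμ.mul_prod hν).const_mul (Real.exp (h 0))).mono' .of_discrete
    (.of_forall fun p => ?_)
  rw [Function.comp_apply, Real.norm_of_nonneg (Real.exp_pos _).le, ← Real.exp_add,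
    ← Real.exp_add, Real.exp_le_exp]
  linarith [le_of_abs_le (hh p.1 p.2), le_of_abs_le (hh.abs_sub_zero_le p.1)]

theorem HasExpMomentBound.conv [SFinite μ] [IsProbabilityMeasure ν] {R S : ℝ}
    (hμ : Integrable (fun x => Real.exp (c x)) μ)
    (hν : Integrable (fun x => Real.exp (c x)) ν) (hR : HasExpMomentBound μ c R)
    (hS : HasExpMomentBound ν c S) : HasExpMomentBound (μ ∗ ν) c (R + S) := fun h hh => by
  have hexp := hh.integrable_exp_conv hμ hν
  have hint : Integrable h (μ ∗ ν) :=
    integrable_of_integrable_exp_abs .of_discrete (hh.abs.integrable_exp_conv hμ hν)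
  have hg := hh.integral_translate hν
  calc ∫ z, Real.exp (h z) ∂(μ ∗ ν) = ∫ x, ∫ y, Real.exp (h (x + y)) ∂ν ∂μ := integral_conv hexp
    _ ≤ ∫ x, Real.exp (∫ y, h (x + y) ∂ν + S) ∂μ := by
        refine integral_mono_of_nonneg
          (.of_forall fun x => integral_nonneg fun y => (Real.exp_pos _).le) ?_
          (.of_forall fun x => hS _ (hh.translate x))
        simpa only [Real.exp_add] using (hg.integrable_exp hμ).mul_const (Real.exp S)
    _ = (∫ x, Real.exp (∫ y, h (x + y) ∂ν) ∂μ) * Real.exp S := by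
        simp only [Real.exp_add, integral_mul_const]
    _ ≤ Real.exp (∫ x, ∫ y, h (x + y) ∂ν ∂μ + R) * Real.exp S := by
        gcongr
        exact hR _ hg
    _ = _ := by rw [← integral_conv hint, ← Real.exp_add, add_assoc]

end Increments

section ConvPow

variable {M : Type*} [AddMonoid M] [MeasurableSpace M]

/-- The `k`-fold convolution power of `μ`: the law of the sum of `k` independent variables with
law `μ`. -/
noncomputable def convPow (μ : Measure M) : ℕ → Measure M
  | 0 => Measure.dirac 0
  | k + 1 => convPow μ k ∗ μ

instance [MeasurableAdd₂ M] (μ : Measure M) [IsProbabilityMeasure μ] (k : ℕ) :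
    IsProbabilityMeasure (convPow μ k) := by
  induction k with
  | zero => exact inferInstanceAs (IsProbabilityMeasure (Measure.dirac (0 : M)))
  | succ k ih => exact inferInstanceAs (IsProbabilityMeasure (convPow μ k ∗ μ))

theorem convPow_zero (μ : Measure M) : convPow μ 0 = Measure.dirac 0 := rfl

theorem convPow_succ (μ : Measure M) (k : ℕ) : convPow μ (k + 1) = convPow μ k ∗ μ := rfl

variable [Countable M] [DiscreteMeasurableSpace M] (μ : Measure M)

theorem convPow_one : convPow μ 1 = μ := Measure.dirac_zero_conv μ

theorem convPow_add (k l : ℕ) : convPow μ (k + l) = convPow μ k ∗ convPow μ l := by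
  induction l with
  | zero => exact (Measure.conv_dirac_zero _).symm
  | succ l ih => rw [← add_assoc, convPow_succ, convPow_succ, ih, Measure.conv_assoc]

theorem lintegral_convPow_of_add [IsProbabilityMeasure μ] {v : M → ℝ≥0∞} (hzero : v 0 = 0)
    (hadd : ∀ x y, v (x + y) = v x + v y) (k : ℕ) :
    ∫⁻ x, v x ∂(convPow μ k) = k * ∫⁻ x, v x ∂μ := by
  induction k with
  | zero => simp [convPow_zero, hzero]
  | succ k ih =>
    rw [convPow_succ, Measure.lintegral_conv .of_discrete]
    simp only [hadd, lintegral_add_left Measurable.of_discrete]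
    simp [ih, add_mul]

theorem lintegral_convPow_le_pow {w : M → ℝ≥0∞} (hzero : w 0 ≤ 1)
    (hadd : ∀ x y, w (x + y) ≤ w x * w y) (k : ℕ) :
    ∫⁻ x, w x ∂(convPow μ k) ≤ (∫⁻ x, w x ∂μ) ^ k := by
  induction k with
  | zero => simpa [convPow_zero] using hzero
  | succ k ih =>
    rw [convPow_succ, Measure.lintegral_conv .of_discrete]
    calc _ ≤ ∫⁻ x, ∫⁻ y, w x * w y ∂μ ∂(convPow μ k) :=
          lintegral_mono fun x => lintegral_mono fun y => hadd x y
      _ = (∫⁻ x, w x ∂(convPow μ k)) * ∫⁻ y, w y ∂μ := by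
          simp only [lintegral_const_mul _ Measurable.of_discrete]
          exact lintegral_mul_const _ .of_discrete
      _ ≤ _ := by
          rw [pow_succ]
          gcongr

end ConvPow

theorem map_sum_range_infinitePi {M : Type*} [AddCommMonoid M] [Countable M] [MeasurableSpace M]
    [DiscreteMeasurableSpace M] (μ : Measure M) [IsProbabilityMeasure μ] (k : ℕ) :
    (Measure.infinitePi fun _ : ℕ => μ).map (fun s => ∑ i ∈ Finset.range k, s i) = convPow μ k := by
  induction k with
  | zero => simp [convPow_zero]
  | succ k ih =>
    have hind := (iIndepFun_infinitePi (P := fun _ : ℕ => μ) (X := fun _ => id)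
      (fun _ => measurable_id)).indepFun_finsetSum_of_notMem
        (fun i => by fun_prop) (s := Finset.range k) (i := k) Finset.notMem_range_self
    have hlaw := hind.map_add_eq_map_conv_map (by fun_prop) (by fun_prop)
    have hsum : (∑ i ∈ Finset.range k, fun s : ℕ → M => id (s i)) =
        fun s => ∑ i ∈ Finset.range k, s i := by
      ext s
      simp
    have heval : (Measure.infinitePi fun _ : ℕ => μ).map (fun s => id (s k)) = μ :=
      Measure.infinitePi_map_eval (fun _ : ℕ => μ) k
    rw [hsum, heval, ih] at hlaw
    simpa only [Finset.sum_range_succ] using! hlaw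

theorem measurable_randomSum :
    Measurable fun p : ℕ × (ℕ → ℕ) => ∑ i ∈ Finset.range p.1, p.2 i :=
  measurable_from_prod_countable_right fun k =>
    Finset.measurable_fun_sum (Finset.range k) fun i _ => measurable_pi_apply i

instance (lam : ℝ≥0) (Q : Measure ℕ) [IsProbabilityMeasure Q] :
    IsProbabilityMeasure (compoundPoisson lam Q) :=
  Measure.isProbabilityMeasure_map measurable_randomSum.aemeasurable

section CompoundPoisson

variable (lam : ℝ≥0) (Q : Measure ℕ) [IsProbabilityMeasure Q]

theorem lintegral_compoundPoisson (h : ℕ → ℝ≥0∞) :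
    ∫⁻ z, h z ∂(compoundPoisson lam Q) = ∫⁻ k, ∫⁻ z, h z ∂(convPow Q k) ∂(poissonMeasure lam) := by
  have hm : Measurable fun p : ℕ × (ℕ → ℕ) => h (∑ i ∈ Finset.range p.1, p.2 i) :=
    (Measurable.of_discrete (f := h)).comp measurable_randomSum
  rw [compoundPoisson, lintegral_map .of_discrete measurable_randomSum,
    lintegral_prod _ hm.aemeasurable]
  refine lintegral_congr fun k => ?_
  rw [← map_sum_range_infinitePi, lintegral_map .of_discrete (by fun_prop)]

theorem compoundPoisson_conv_compoundPoisson (a b : ℝ≥0) :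
    compoundPoisson a Q ∗ compoundPoisson b Q = compoundPoisson (a + b) Q := by
  refine Measure.ext_of_lintegral _ fun h _ => ?_
  calc ∫⁻ z, h z ∂(compoundPoisson a Q ∗ compoundPoisson b Q)
      = ∫⁻ k, ∫⁻ x, ∫⁻ l, ∫⁻ y, h (x + y)
          ∂(convPow Q l) ∂(poissonMeasure b) ∂(convPow Q k) ∂(poissonMeasure a) := by
        simp only [Measure.lintegral_conv Measurable.of_discrete, lintegral_compoundPoisson]
    _ = ∫⁻ k, ∫⁻ l, ∫⁻ z, h z ∂(convPow Q (k + l)) ∂(poissonMeasure b) ∂(poissonMeasure a) := by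
        refine lintegral_congr fun k => ?_
        rw [lintegral_lintegral_swap (Measurable.of_discrete.aemeasurable)]
        simp only [convPow_add, Measure.lintegral_conv Measurable.of_discrete]
    _ = ∫⁻ z, h z ∂(compoundPoisson (a + b) Q) := by
        rw [lintegral_compoundPoisson, ← poissonMeasure_conv_poissonMeasure,
          Measure.lintegral_conv .of_discrete]

theorem hasSum_natCast_mul_poissonMeasure :
    HasSum (fun k : ℕ => k * (Real.exp (-lam) * lam ^ k / k.factorial)) lam := by
  rw [← hasSum_nat_add_iff' 1]
  have hk : ∀ k : ℕ, ((k : ℝ) + 1) * (Real.exp (-lam) * lam ^ (k + 1) / (k + 1).factorial) =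
      lam * (Real.exp (-lam) * lam ^ k / k.factorial) := fun k => by
    rw [Nat.factorial_succ]
    push_cast
    field_simp
    ring
  simpa [hk] using (hasSum_one_poissonMeasure lam).mul_left (lam : ℝ)

theorem lintegral_natCast_poissonMeasure : ∫⁻ k, (k : ℝ≥0∞) ∂(poissonMeasure lam) = lam := by
  have hs := hasSum_natCast_mul_poissonMeasure lam
  rw [lintegral_countable', ← ENNReal.ofReal_coe_nnreal, ← hs.tsum_eq,
    ENNReal.ofReal_tsum_of_nonneg (fun k => by positivity) hs.summable]
  simp only [poissonMeasure_singleton, ENNReal.ofReal_mul (Nat.cast_nonneg _),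
    ENNReal.ofReal_natCast]

theorem integrable_pow_poissonMeasure (a : ℝ) :
    Integrable (fun k => a ^ k) (poissonMeasure lam) := by
  rw [integrable_poissonMeasure_iff]
  refine ((Real.summable_pow_div_factorial (lam * |a|)).mul_left (Real.exp (-lam))).congr
    fun k => ?_
  rw [norm_pow, Real.norm_eq_abs, mul_pow]
  ring

theorem hasSum_pow_add_two_div_factorial (x : ℝ) :
    HasSum (fun k : ℕ => x ^ (k + 2) / (k + 2).factorial) (Real.exp x - 1 - x) := by
  have h := NormedSpace.expSeries_div_hasSum_exp (𝔸 := ℝ) x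
  rw [← Real.exp_eq_exp_ℝ, ← hasSum_nat_add_iff' 2] at h
  simpa [Finset.sum_range_succ, sub_sub] using h

theorem lintegral_poissonMeasure_le {a : ℝ} (ha : 0 ≤ a) {b : ℕ → ℝ≥0∞} (hb0 : b 0 = 0)
    (hb : ∀ k, b k ≤ ENNReal.ofReal a ^ k) :
    ∫⁻ k, b k ∂(poissonMeasure lam) ≤
      lam * b 1 + ENNReal.ofReal (Real.exp (lam * a) - 1 - lam * a) := by
  have hs := hasSum_pow_add_two_div_factorial (lam * a)
  rw [lintegral_countable', tsum_eq_zero_add' ENNReal.summable,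
    tsum_eq_zero_add' ENNReal.summable, hb0, zero_mul, zero_add, ← hs.tsum_eq,
    ENNReal.ofReal_tsum_of_nonneg (fun k => by positivity) hs.summable]
  have hw : ∀ k, poissonMeasure lam {k} ≤ ENNReal.ofReal (lam ^ k / k.factorial) := fun k => by
    rw [poissonMeasure_singleton, mul_div_assoc]
    refine ENNReal.ofReal_le_ofReal (mul_le_of_le_one_left (by positivity) ?_)
    simp
  refine add_le_add ?_ (ENNReal.tsum_le_tsum fun k => ?_)
  · rw [mul_comm]
    simpa using mul_le_mul_left (hw 1) (b 1)
  · calc _ ≤ ENNReal.ofReal a ^ (k + 2) * ENNReal.ofReal (lam ^ (k + 2) / (k + 2).factorial) := by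
          gcongr
          exacts [hb _, hw _]
      _ = _ := by
          rw [← ENNReal.ofReal_pow ha, ← ENNReal.ofReal_mul (by positivity), mul_pow]
          congr 1
          ring

end CompoundPoisson

section SmallTime

variable {lam : ℝ≥0} {Q : Measure ℕ} {c : ℕ → ℝ}

theorem lintegral_exp_convPow_le_pow (hc0 : c 0 = 0) (hsub : ∀ x y, c (x + y) ≤ c x + c y)
    (hexp : Integrable (fun j => Real.exp (c j)) Q) (k : ℕ) :
    ∫⁻ x, ENNReal.ofReal (Real.exp (c x)) ∂(convPow Q k) ≤
      ENNReal.ofReal (∫ j, Real.exp (c j) ∂Q) ^ k := by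
  rw [ofReal_integral_eq_lintegral_ofReal hexp (.of_forall fun j => (Real.exp_pos _).le)]
  refine lintegral_convPow_le_pow Q (by simp [hc0]) (fun x y => ?_) k
  rw [← ENNReal.ofReal_mul (Real.exp_pos _).le, ← Real.exp_add]
  exact ENNReal.ofReal_le_ofReal (Real.exp_le_exp.2 (hsub x y))

variable [IsProbabilityMeasure Q]

theorem integrable_exp_compoundPoisson (hc0 : c 0 = 0) (hsub : ∀ x y, c (x + y) ≤ c x + c y)
    (hexp : Integrable (fun j => Real.exp (c j)) Q) :
    Integrable (fun x => Real.exp (c x)) (compoundPoisson lam Q) := by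
  have hA : 0 ≤ ∫ j, Real.exp (c j) ∂Q := integral_nonneg fun j => (Real.exp_pos _).le
  refine ⟨.of_discrete, ?_⟩
  rw [hasFiniteIntegral_iff_ofReal (.of_forall fun j => (Real.exp_pos _).le),
    lintegral_compoundPoisson]
  refine (lintegral_mono (lintegral_exp_convPow_le_pow hc0 hsub hexp)).trans_lt ?_
  simp only [← ENNReal.ofReal_pow hA]
  exact (hasFiniteIntegral_iff_ofReal (.of_forall fun k => pow_nonneg hA k)).1
    (integrable_pow_poissonMeasure lam _).2

theorem integral_exp_sub_one_sub_compoundPoisson_le (hc0 : c 0 = 0)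
    (hc : ∀ x, 0 ≤ c x) (hsub : ∀ x y, c (x + y) ≤ c x + c y)
    (hexp : Integrable (fun j => Real.exp (c j)) Q) :
    ∫ x, (Real.exp (c x) - 1 - c x) ∂(compoundPoisson lam Q) ≤
      lam * ∫ j, (Real.exp (c j) - 1 - c j) ∂Q +
        (Real.exp (lam * ∫ j, Real.exp (c j) ∂Q) - 1 - lam * ∫ j, Real.exp (c j) ∂Q) := by
  have hr : ∀ x, 0 ≤ Real.exp (c x) - 1 - c x := fun x => exp_sub_one_sub_nonneg (c x)
  have hS : 0 ≤ lam * ∫ j, (Real.exp (c j) - 1 - c j) ∂Q := mul_nonneg lam.2 (integral_nonneg hr)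
  have hri : Integrable (fun j => Real.exp (c j) - 1 - c j) Q := by
    refine (hexp.sub (integrable_const 1)).sub
      (integrable_of_integrable_exp_abs .of_discrete ?_)
    simpa only [abs_of_nonneg (hc _)] using hexp
  have hb : ∀ k, ∫⁻ x, ENNReal.ofReal (Real.exp (c x) - 1 - c x) ∂(convPow Q k) ≤
      ENNReal.ofReal (∫ j, Real.exp (c j) ∂Q) ^ k := fun k =>
    (lintegral_mono fun x => ENNReal.ofReal_le_ofReal (by linarith [hc x])).trans
      (lintegral_exp_convPow_le_pow hc0 hsub hexp k)
  rw [integral_eq_lintegral_of_nonneg_ae (.of_forall hr) .of_discrete, lintegral_compoundPoisson]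
  refine ENNReal.toReal_le_of_le_ofReal (add_nonneg hS (exp_sub_one_sub_nonneg _))
    ((lintegral_poissonMeasure_le lam (integral_nonneg fun j => (Real.exp_pos _).le)
      (by simp [convPow_zero, hc0]) hb).trans_eq ?_)
  rw [convPow_one,
    ENNReal.ofReal_add hS (exp_sub_one_sub_nonneg _), ENNReal.ofReal_mul lam.coe_nonneg,
    ofReal_integral_eq_lintegral_ofReal hri (.of_forall hr), ENNReal.ofReal_coe_nnreal]

theorem HasExpMomentBound.compoundPoisson_nsmul {R : ℝ} (hc0 : c 0 = 0)
    (hsub : ∀ x y, c (x + y) ≤ c x + c y) (hexp : Integrable (fun j => Real.exp (c j)) Q)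
    (hR : HasExpMomentBound (compoundPoisson lam Q) c R) (n : ℕ) :
    HasExpMomentBound (compoundPoisson ((n + 1) * lam) Q) c ((n + 1) * R) := by
  induction n with
  | zero => simpa using hR
  | succ n ih =>
    have h := ih.conv (integrable_exp_compoundPoisson hc0 hsub hexp)
      (integrable_exp_compoundPoisson hc0 hsub hexp) hR
    rw [compoundPoisson_conv_compoundPoisson] at h
    push_cast
    rwa [add_mul _ 1 lam, one_mul, add_mul _ 1 R, one_mul]

open Filter Topology in
theorem tendsto_mul_exp_div_sub_one_sub (x : ℝ) :
    Tendsto (fun n : ℕ => (n + 1 : ℝ) * (Real.exp (x / (n + 1)) - 1 - x / (n + 1))) atTop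
      (𝓝 0) := by
  have hlim : Tendsto (fun n : ℕ => x ^ 2 * (1 / (n + 1 : ℝ))) atTop (𝓝 0) := by
    simpa using tendsto_one_div_add_atTop_nhds_zero_nat.const_mul (x ^ 2)
  refine squeeze_zero_norm' ?_ hlim
  filter_upwards [eventually_ge_atTop ⌈|x|⌉₊] with n hn
  have hx : |x / (n + 1)| ≤ 1 := by
    rw [abs_div, abs_of_nonneg (by positivity : (0 : ℝ) ≤ n + 1), div_le_one (by positivity)]
    linarith [Nat.ceil_le.1 hn]
  calc ‖(n + 1 : ℝ) * (Real.exp (x / (n + 1)) - 1 - x / (n + 1))‖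
      = (n + 1) * |Real.exp (x / (n + 1)) - 1 - x / (n + 1)| := by
        rw [norm_mul, Real.norm_of_nonneg (by positivity), Real.norm_eq_abs]
    _ ≤ (n + 1) * (x / (n + 1)) ^ 2 := by
        gcongr
        exact Real.abs_exp_sub_one_sub_id_le hx
    _ = x ^ 2 * (1 / (n + 1)) := by field_simp

open Filter Topology in
theorem hasExpMomentBound_compoundPoisson (hc0 : c 0 = 0)
    (hsub : ∀ x y, c (x + y) ≤ c x + c y) (hexp : Integrable (fun j => Real.exp (c j)) Q) :
    HasExpMomentBound (compoundPoisson lam Q) c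
      (lam * ∫ j, (Real.exp (c j) - 1 - c j) ∂Q) := fun h hh => by
  have hc : ∀ x, 0 ≤ c x := fun x => (abs_nonneg _).trans (hh.abs_sub_zero_le x)
  set A := ∫ j, Real.exp (c j) ∂Q with hA
  set S := ∫ j, (Real.exp (c j) - 1 - c j) ∂Q with hS
  have hstep : ∀ n : ℕ, ∫ x, Real.exp (h x) ∂(compoundPoisson lam Q) ≤
      Real.exp (∫ x, h x ∂(compoundPoisson lam Q) + (lam * S +
        (n + 1) * (Real.exp (lam * A / (n + 1)) - 1 - lam * A / (n + 1)))) := fun n => by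
    have hn : (n + 1) * (lam / (n + 1)) = lam := by field_simp
    have hb := (hasExpMomentBound_integral (integrable_exp_compoundPoisson
      (lam := lam / (n + 1)) hc0 hsub hexp)).compoundPoisson_nsmul hc0 hsub hexp n h hh
    rw [hn] at hb
    refine hb.trans (Real.exp_le_exp.2 ?_)
    have hsmall := mul_le_mul_of_nonneg_left (integral_exp_sub_one_sub_compoundPoisson_le
      (lam := lam / (n + 1)) hc0 hc hsub hexp) (by positivity : (0 : ℝ) ≤ n + 1)
    gcongr
    refine hsmall.trans_eq ?_
    rw [← hA, ← hS]
    push_cast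
    field_simp
  have hlim := ((tendsto_mul_exp_div_sub_one_sub (lam * A)).const_add (lam * S)).const_add
    (∫ x, h x ∂(compoundPoisson lam Q))
  rw [add_zero] at hlim
  exact ge_of_tendsto' ((Real.continuous_exp.tendsto _).comp hlim) hstep

end SmallTime

section LegendreDuality

variable {D : Set ℝ} {F f : ℝ → ℝ} {s₀ α : ℝ}

/-- The generalized inverse of `f` on the positive part of `D`: the supremum of the `α > 0` in `D`
with `f α ≤ s`, so that it is `sup D` above the range of `f`. -/
noncomputable def generalizedInv (D : Set ℝ) (f : ℝ → ℝ) (s : ℝ) : ℝ≥0∞ :=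
  ⨆ (α : ℝ) (_ : 0 < α ∧ α ∈ D ∧ f α ≤ s), ENNReal.ofReal α

theorem le_generalizedInv {s : ℝ} (h0 : 0 < α) (hα : α ∈ D) (hs : f α ≤ s) :
    ENNReal.ofReal α ≤ generalizedInv D f s :=
  le_iSup₂_of_le α ⟨h0, hα, hs⟩ le_rfl

theorem generalizedInv_apply_of_strictMonoOn (hf : StrictMonoOn f D) (h0 : 0 < α) (hα : α ∈ D) :
    generalizedInv D f (f α) = ENNReal.ofReal α :=
  le_antisymm (iSup₂_le fun _ hb => ENNReal.ofReal_le_ofReal ((hf.le_iff_le hb.2.1 hα).1 hb.2.2))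
    (le_generalizedInv h0 hα le_rfl)

theorem generalizedInv_eq_zero_of_neg (hf : MonotoneOn f D) (h0D : 0 ∈ D) (hf0 : f 0 = 0) {s : ℝ}
    (hs : s < 0) : generalizedInv D f s = 0 := by
  refine le_zero_iff.1 (iSup₂_le fun a ha => absurd (hf h0D ha.2.1 ha.1.le) ?_)
  linarith [ha.2.2]

theorem generalizedInv_eq_volume [hD : D.OrdConnected] (hf : MonotoneOn f D) (h0D : 0 ∈ D) (s : ℝ) :
    generalizedInv D f s = volume {a | a ∈ D ∩ Set.Ioi 0 ∧ f a ≤ s} := by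
  apply le_antisymm
  · refine iSup₂_le fun a ha => ?_
    have hsub : Set.Ioc 0 a ⊆ {a | a ∈ D ∩ Set.Ioi 0 ∧ f a ≤ s} := fun b hb =>
      have hbD : b ∈ D := hD.out h0D ha.2.1 ⟨hb.1.le, hb.2⟩
      ⟨⟨hbD, hb.1⟩, (hf hbD ha.2.1 hb.2).trans ha.2.2⟩
    simpa using measure_mono (μ := volume) hsub
  · by_cases htop : generalizedInv D f s = ∞
    · simp [htop]
    · have hsub : {a | a ∈ D ∩ Set.Ioi 0 ∧ f a ≤ s} ⊆ Set.Ioc 0 (generalizedInv D f s).toReal :=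
        fun a ha => ⟨ha.1.2, (ENNReal.ofReal_le_iff_le_toReal htop).1
          (le_generalizedInv ha.1.2 ha.1.1 ha.2)⟩
      refine (measure_mono hsub).trans ?_
      simp [htop]

theorem setLIntegral_Ioi_comp_sub_left (g : ℝ → ℝ≥0∞) (s₀ : ℝ) :
    ∫⁻ t in Set.Ioi 0, g (s₀ - t) = ∫⁻ s in Set.Iio s₀, g s := by
  have h := (Measure.measurePreserving_sub_left volume s₀).setLIntegral_comp_preimage_emb
    (Homeomorph.subLeft s₀).measurableEmbedding g (Set.Iio s₀)
  simpa using h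

theorem setLIntegral_Iio_eq_Ioc {g : ℝ → ℝ≥0∞} (hg : ∀ s < 0, g s = 0) (s₀ : ℝ) :
    ∫⁻ s in Set.Iio s₀, g s = ∫⁻ s in Set.Ioc 0 s₀, g s := by
  rw [← lintegral_indicator measurableSet_Iio, ← lintegral_indicator measurableSet_Ioc]
  refine lintegral_congr_ae ?_
  filter_upwards [Measure.ae_ne volume 0, Measure.ae_ne volume s₀] with s h0 hs
  rcases lt_or_gt_of_ne h0 with hneg | hpos
  · simp [Set.indicator, hg s hneg]
  · simp [Set.indicator, hpos, lt_iff_le_and_ne, hs]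

theorem setLIntegral_generalizedInv [hD : D.OrdConnected] (hf : MonotoneOn f D) (h0D : 0 ∈ D)
    (hf0 : f 0 = 0) (s₀ : ℝ) :
    ∫⁻ s in Set.Ioc 0 s₀, generalizedInv D f s =
      ∫⁻ a in D ∩ Set.Ioi 0, ENNReal.ofReal (s₀ - f a) := by
  have hE : MeasurableSet (D ∩ Set.Ioi 0) := hD.measurableSet.inter measurableSet_Ioi
  have hfm : AEMeasurable f (volume.restrict (D ∩ Set.Ioi 0)) :=
    aemeasurable_restrict_of_monotoneOn hE (hf.mono Set.inter_subset_left)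
  symm
  calc ∫⁻ a in D ∩ Set.Ioi 0, ENNReal.ofReal (s₀ - f a)
      = ∫⁻ a in D ∩ Set.Ioi 0, ENNReal.ofReal (max (s₀ - f a) 0) := by
        simp only [ENNReal.ofReal_max, ENNReal.ofReal_zero, max_zero]
    _ = ∫⁻ t in Set.Ioi 0, volume.restrict (D ∩ Set.Ioi 0) {a | t ≤ max (s₀ - f a) 0} :=
        lintegral_eq_lintegral_meas_le _ (.of_forall fun a => le_max_right _ _)
          ((hfm.const_sub s₀).max aemeasurable_const)
    _ = ∫⁻ t in Set.Ioi 0, generalizedInv D f (s₀ - t) := by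
        refine setLIntegral_congr_fun measurableSet_Ioi fun t ht => ?_
        rw [Measure.restrict_apply' hE, generalizedInv_eq_volume hf h0D, Set.inter_comm]
        congr 1
        ext a
        simpa [(show (0 : ℝ) < t from ht).not_ge, le_sub_comm, and_assoc] using fun h _ _ => h
    _ = ∫⁻ s in Set.Ioc 0 s₀, generalizedInv D f s := by
        rw [setLIntegral_Ioi_comp_sub_left,
          setLIntegral_Iio_eq_Ioc fun s => generalizedInv_eq_zero_of_neg hf h0D hf0]

theorem ofReal_integral_le_lintegral_ofReal {X : Type*} [MeasurableSpace X] {μ : Measure X}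
    {g : X → ℝ} (hg : Integrable g μ) :
    ENNReal.ofReal (∫ x, g x ∂μ) ≤ ∫⁻ x, ENNReal.ofReal (g x) ∂μ := by
  rw [integral_eq_lintegral_pos_part_sub_lintegral_neg_part hg]
  exact (ENNReal.ofReal_le_ofReal (sub_le_self _ ENNReal.toReal_nonneg)).trans
    ENNReal.ofReal_toReal_le

theorem integrableOn_const_sub_of_monotoneOn [hD : D.OrdConnected] (hf : MonotoneOn f D)
    (h0D : 0 ∈ D) (hα : α ∈ D) (s₀ : ℝ) : IntegrableOn (fun a => s₀ - f a) (Set.Ioc 0 α) := by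
  have hmono : MonotoneOn f (Set.Icc 0 α) := hf.mono (hD.out h0D hα)
  exact (integrableOn_const (by simp)).sub
    ((hmono.integrableOn_isCompact isCompact_Icc).mono_set Set.Ioc_subset_Icc_self)

theorem setIntegral_Ioc_const_sub_deriv [hD : D.OrdConnected] (hF : ∀ a ∈ D, HasDerivAt F (f a) a)
    (hf : MonotoneOn f D) (h0D : 0 ∈ D) (hF0 : F 0 = 0) (h0 : 0 ≤ α) (hα : α ∈ D) (s₀ : ℝ) :
    ∫ a in Set.Ioc 0 α, (s₀ - f a) = α * s₀ - F α := by
  have hd : ∀ a ∈ Set.uIcc 0 α, HasDerivAt (fun a => a * s₀ - F a) (s₀ - f a) a := fun a ha => by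
    rw [Set.uIcc_of_le h0] at ha
    simpa using (hasDerivAt_mul_const s₀).fun_sub (hF a (hD.out h0D hα ha))
  rw [← intervalIntegral.integral_of_le h0, intervalIntegral.integral_eq_sub_of_hasDerivAt hd
    ((intervalIntegrable_iff_integrableOn_Ioc_of_le h0).2
      (integrableOn_const_sub_of_monotoneOn hf h0D hα s₀)), hF0]
  simp

theorem setLIntegral_Ioc_const_sub_deriv [hD : D.OrdConnected]
    (hF : ∀ a ∈ D, HasDerivAt F (f a) a) (hf : MonotoneOn f D) (h0D : 0 ∈ D) (hF0 : F 0 = 0)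
    (h0 : 0 ≤ α) (hα : α ∈ D) (hs : f α ≤ s₀) :
    ∫⁻ a in Set.Ioc 0 α, ENNReal.ofReal (s₀ - f a) = ENNReal.ofReal (α * s₀ - F α) := by
  rw [← setIntegral_Ioc_const_sub_deriv hF hf h0D hF0 h0 hα, ofReal_integral_eq_lintegral_ofReal
    (integrableOn_const_sub_of_monotoneOn hf h0D hα s₀)]
  refine (ae_restrict_iff' measurableSet_Ioc).2 (.of_forall fun a ha => sub_nonneg.2 ?_)
  exact (hf (hD.out h0D hα ⟨ha.1.le, ha.2⟩) hα ha.2).trans hs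

/- The integrand vanishes past the point where `f` crosses the level `s₀`; such a point exists by
Darboux's theorem, since `f` need not be continuous. -/
theorem exists_setLIntegral_Ioc_const_sub_deriv_le [hD : D.OrdConnected]
    (hF : ∀ a ∈ D, HasDerivAt F (f a) a) (hf : MonotoneOn f D) (h0D : 0 ∈ D) (hF0 : F 0 = 0)
    (hf0 : f 0 = 0) (hs₀ : 0 < s₀) (hα : α ∈ D ∩ Set.Ioi 0) :
    ∃ β ∈ D ∩ Set.Ioi 0, ∫⁻ a in Set.Ioc 0 α, ENNReal.ofReal (s₀ - f a) ≤
      ENNReal.ofReal (β * s₀ - F β) := by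
  have h0 : 0 < α := hα.2
  rcases le_or_gt (f α) s₀ with h | h
  · exact ⟨α, hα, (setLIntegral_Ioc_const_sub_deriv hF hf h0D hF0 h0.le hα.1 h).le⟩
  · obtain ⟨β, hβ, hβs⟩ := exists_hasDerivWithinAt_eq_of_gt_of_lt h0.le
      (fun a ha => (hF a (hD.out h0D hα.1 ha)).hasDerivWithinAt) (by rwa [hf0]) h
    have hβD : β ∈ D := hD.out h0D hα.1 ⟨hβ.1.le, hβ.2.le⟩
    have hzero : ∫⁻ a in Set.Ioc β α, ENNReal.ofReal (s₀ - f a) = 0 := by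
      refine setLIntegral_eq_zero measurableSet_Ioc fun a ha => ENNReal.ofReal_eq_zero.2 ?_
      rw [sub_nonpos, ← hβs]
      exact hf hβD (hD.out h0D hα.1 ⟨(hβ.1.trans ha.1).le, ha.2⟩) ha.1.le
    refine ⟨β, ⟨hβD, hβ.1⟩, ?_⟩
    rw [← setLIntegral_Ioc_const_sub_deriv hF hf h0D hF0 hβ.1.le hβD hβs.le,
      ← Set.Ioc_union_Ioc_eq_Ioc hβ.1.le hβ.2.le]
    exact (lintegral_union_le _ _ _).trans_eq (by rw [hzero, add_zero])

theorem setLIntegral_inter_Ioi_le (hD : IsOpen D)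
    {g : ℝ → ℝ≥0∞} {S : ℝ≥0∞} (h : ∀ α ∈ D ∩ Set.Ioi 0, ∫⁻ a in Set.Ioc 0 α, g a ≤ S) :
    ∫⁻ a in D ∩ Set.Ioi 0, g a ≤ S := by
  let I := {q : ℚ // (q : ℝ) ∈ D ∩ Set.Ioi 0}
  have hsub : D ∩ Set.Ioi 0 ⊆ ⋃ q : I, Set.Ioc 0 ((q : ℚ) : ℝ) := fun a ha => by
    obtain ⟨b, hab, hb⟩ := mem_nhdsGE_iff_exists_Ico_subset.1
      (mem_nhdsWithin_of_mem_nhds (hD.mem_nhds ha.1))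
    obtain ⟨q, haq, hqb⟩ := exists_rat_btwn (show a < b from hab)
    exact Set.mem_iUnion.2 ⟨⟨q, hb ⟨haq.le, hqb⟩, ha.2.trans haq⟩, ha.2, haq.le⟩
  have hmono : Monotone fun q : I => Set.Ioc 0 ((q : ℚ) : ℝ) := fun p q hpq =>
    Set.Ioc_subset_Ioc_right (Rat.cast_le.2 hpq)
  refine (lintegral_mono_set hsub).trans ?_
  rw [setLIntegral_iUnion_of_directed _ hmono.directed_le]
  exact iSup_le fun q => h _ q.2

theorem setLIntegral_generalizedInv_eq_iSup [hoc : D.OrdConnected] (hD : IsOpen D)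
    (hF : ∀ a ∈ D, HasDerivAt F (f a) a) (hf : MonotoneOn f D) (h0D : 0 ∈ D) (hF0 : F 0 = 0)
    (hf0 : f 0 = 0) (hs₀ : 0 < s₀) :
    ∫⁻ s in Set.Ioc 0 s₀, generalizedInv D f s =
      ⨆ (α : ℝ) (_ : 0 < α ∧ α ∈ D), ENNReal.ofReal (α * s₀ - F α) := by
  rw [setLIntegral_generalizedInv hf h0D hf0]
  apply le_antisymm
  · refine setLIntegral_inter_Ioi_le hD fun α hα => ?_
    obtain ⟨β, hβ, hle⟩ :=
      exists_setLIntegral_Ioc_const_sub_deriv_le hF hf h0D hF0 hf0 hs₀ hα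
    exact hle.trans (le_iSup₂_of_le β hβ.symm le_rfl)
  · refine iSup₂_le fun α ⟨h0, hα⟩ => ?_
    rw [← setIntegral_Ioc_const_sub_deriv hF hf h0D hF0 h0.le hα]
    exact (ofReal_integral_le_lintegral_ofReal
      (integrableOn_const_sub_of_monotoneOn hf h0D hα s₀)).trans
      (lintegral_mono_set fun a ha => ⟨hoc.out h0D hα ⟨ha.1.le, ha.2⟩, ha.1⟩)

theorem iInf_coe_eq_neg_coe_iSup_ofReal {ι : Type*} {p : ι → Prop} {g : ι → ℝ}
    (h : ∃ i, p i ∧ g i ≤ 0) :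
    (⨅ (i) (_ : p i), (g i : EReal)) =
      -((⨆ (i) (_ : p i), ENNReal.ofReal (-g i) : ℝ≥0∞) : EReal) := by
  set m : EReal := ⨅ (i) (_ : p i), (g i : EReal)
  have hm : ∀ i, p i → ((-g i : ℝ) : EReal) ≤ -m := fun i hi => by
    rw [EReal.coe_neg, EReal.neg_le_neg_iff]
    exact iInf₂_le i hi
  apply le_antisymm
  · obtain ⟨i, hi, hgi⟩ := h
    have hm0 : 0 ≤ -m := le_trans (EReal.coe_nonneg.2 (neg_nonneg.2 hgi)) (hm i hi)
    rw [EReal.le_neg, ← EReal.coe_toENNReal hm0, EReal.coe_ennreal_le_coe_ennreal_iff]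
    exact iSup₂_le fun j hj => by
      simpa using EReal.toENNReal_le_toENNReal (hm j hj)
  · refine le_iInf₂ fun i hi => ?_
    rw [EReal.neg_le, ← EReal.coe_neg]
    refine (EReal.coe_le_coe_iff.2 (le_max_left (-g i) 0)).trans ?_
    rw [← EReal.coe_ennreal_ofReal, EReal.coe_ennreal_le_coe_ennreal_iff]
    exact le_iSup₂_of_le i hi le_rfl

open Topology in
theorem exists_lt_mul_of_hasDerivAt_zero (hD : IsOpen D) (h0D : 0 ∈ D) (hF : HasDerivAt F 0 0)
    (hF0 : F 0 = 0) (hs₀ : 0 < s₀) : ∃ α, (0 < α ∧ α ∈ D) ∧ F α < α * s₀ := by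
  obtain ⟨α, hslope, hα⟩ := ((hF.tendsto_slope_zero_right.eventually_lt_const hs₀).and
    (inter_mem_nhdsWithin (Set.Ioi 0) (hD.mem_nhds h0D))).exists
  refine ⟨α, hα, ?_⟩
  rwa [zero_add, hF0, sub_zero, smul_eq_mul, inv_mul_lt_iff₀ hα.1] at hslope

theorem iInf_sub_mul_eq_neg_setLIntegral_generalizedInv [D.OrdConnected] (hD : IsOpen D)
    (hF : ∀ a ∈ D, HasDerivAt F (f a) a) (hf : MonotoneOn f D) (h0D : 0 ∈ D) (hF0 : F 0 = 0)
    (hf0 : f 0 = 0) (hs₀ : 0 < s₀) :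
    (⨅ (α : ℝ) (_ : 0 < α ∧ α ∈ D), ((F α - α * s₀ : ℝ) : EReal)) =
      -((∫⁻ s in Set.Ioc 0 s₀, generalizedInv D f s : ℝ≥0∞) : EReal) := by
  have hderiv : HasDerivAt F 0 0 := by simpa only [hf0] using hF 0 h0D
  obtain ⟨α, hα, hlt⟩ := exists_lt_mul_of_hasDerivAt_zero hD h0D hderiv hF0 hs₀
  rw [setLIntegral_generalizedInv_eq_iSup hD hF hf h0D hF0 hf0 hs₀,
    iInf_coe_eq_neg_coe_iSup_ofReal (g := fun α => F α - α * s₀) ⟨α, hα, sub_nonpos.2 hlt.le⟩]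
  simp only [neg_sub]

end LegendreDuality

section Mean

variable {lam : ℝ≥0} {Q : Measure ℕ}

theorem firstMoment_nonneg : 0 ≤ firstMoment Q := tsum_nonneg fun j => by positivity

theorem integrable_of_summable_measureReal_mul [IsFiniteMeasure Q] {g : ℕ → ℝ}
    (hg : Summable fun j => Q.real {j} * |g j|) : Integrable g Q := by
  rw [← Measure.sum_smul_dirac Q]
  exact integrable_sum_dirac (fun j => measure_ne_top Q _) hg

variable [IsProbabilityMeasure Q]

theorem lintegral_natCast_compoundPoisson :
    ∫⁻ z, (z : ℝ≥0∞) ∂(compoundPoisson lam Q) = lam * ∫⁻ j, (j : ℝ≥0∞) ∂Q := by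
  rw [lintegral_compoundPoisson]
  simp only [lintegral_convPow_of_add Q Nat.cast_zero fun x y : ℕ => Nat.cast_add x y]
  rw [lintegral_mul_const _ .of_discrete, lintegral_natCast_poissonMeasure]

theorem lintegral_ofReal_natCast_compoundPoisson
    (hs : Summable fun j : ℕ => (j : ℝ) * Q.real {j}) :
    ∫⁻ z : ℕ, ENNReal.ofReal z ∂(compoundPoisson lam Q) =
      lam * ENNReal.ofReal (firstMoment Q) := by
  have hi : Integrable (fun j : ℕ => (j : ℝ)) Q :=
    integrable_of_summable_measureReal_mul (by simpa [mul_comm] using hs)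
  have hmean : ∫ j, (j : ℝ) ∂Q = firstMoment Q := by
    rw [integral_countable hi, firstMoment]
    exact tsum_congr fun j => mul_comm _ _
  rw [← hmean, ofReal_integral_eq_lintegral_ofReal hi (.of_forall fun j => by positivity)]
  simpa only [ENNReal.ofReal_natCast] using lintegral_natCast_compoundPoisson

theorem integrable_natCast_compoundPoisson (hs : Summable fun j : ℕ => (j : ℝ) * Q.real {j}) :
    Integrable (fun z : ℕ => (z : ℝ)) (compoundPoisson lam Q) := by
  refine ⟨.of_discrete, ?_⟩
  rw [hasFiniteIntegral_iff_ofReal (.of_forall fun z => by positivity),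
    lintegral_ofReal_natCast_compoundPoisson hs]
  finiteness

theorem integral_natCast_compoundPoisson (hs : Summable fun j : ℕ => (j : ℝ) * Q.real {j}) :
    ∫ z, (z : ℝ) ∂(compoundPoisson lam Q) = lam * firstMoment Q := by
  rw [integral_eq_lintegral_of_nonneg_ae (.of_forall fun z => by positivity) .of_discrete,
    lintegral_ofReal_natCast_compoundPoisson hs, ENNReal.toReal_mul,
    ENNReal.toReal_ofReal firstMoment_nonneg, ENNReal.coe_toReal]

end Mean

section RateFunction

variable {lam : ℝ≥0} {Q : Measure ℕ} {K ε α : ℝ}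

/-- The orders `α` with `α < L`, as a subset of the whole line: the rate function and its derivative
are finite there, also for `α ≤ 0`. -/
def subcriticalOrders (Q : Measure ℕ) : Set ℝ := {α | ENNReal.ofReal α < momentOrder Q}

theorem isOpen_subcriticalOrders : IsOpen (subcriticalOrders Q) :=
  isOpen_Iio.preimage ENNReal.continuous_ofReal

theorem subcriticalOrders_mem_of_le {a b : ℝ} (hb : b ∈ subcriticalOrders Q) (hab : a ≤ b) :
    a ∈ subcriticalOrders Q :=
  (ENNReal.ofReal_le_ofReal hab).trans_lt hb

instance : (subcriticalOrders Q).OrdConnected :=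
  ⟨fun _ _ _ hb _ hx => subcriticalOrders_mem_of_le hb hx.2⟩

theorem exists_summable_rpow_of_mem (hα : α ∈ subcriticalOrders Q) :
    ∃ τ : ℝ, 1 ≤ τ ∧ α < τ ∧ Summable fun j : ℕ => (j : ℝ) ^ τ * Q.real {j} := by
  obtain ⟨τ, hτ⟩ := lt_iSup_iff.1 (show _ < momentOrder Q from hα)
  obtain ⟨⟨h1, hs⟩, hlt⟩ := lt_iSup_iff.1 hτ
  exact ⟨τ, h1, (ENNReal.ofReal_lt_ofReal_iff (one_pos.trans_le h1)).1 hlt, hs⟩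

theorem summable_natCast_mul_measureReal (h1 : 1 ∈ subcriticalOrders Q) :
    Summable fun j : ℕ => (j : ℝ) * Q.real {j} := by
  obtain ⟨τ, hτ, -, hs⟩ := exists_summable_rpow_of_mem h1
  refine hs.of_nonneg_of_le (fun j => by positivity) fun j => ?_
  rcases j.eq_zero_or_pos with rfl | hj
  · simp [(one_pos.trans_le hτ).ne']
  · gcongr
    exact Real.self_le_rpow_of_one_le (mod_cast hj) hτ

theorem one_le_coeffC (hK : 0 ≤ K) (hε : 0 < ε) (j : ℕ) : 1 ≤ coeffC K ε j :=
  le_add_of_nonneg_right (by positivity)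

theorem summable_measureReal_mul_coeffC_rpow (hK : 0 ≤ K) (hε : 0 < ε) {τ : ℝ} (hτ : 0 ≤ τ)
    (hs : Summable fun j : ℕ => (j : ℝ) ^ τ * Q.real {j}) :
    Summable fun j : ℕ => Q.real {j} * coeffC K ε j ^ τ := by
  refine .of_norm_bounded_eventually_nat (hs.mul_left ((1 + K / ε) ^ τ)) ?_
  filter_upwards [Filter.eventually_ge_atTop 1] with j hj
  have hC := one_le_coeffC hK hε j
  have hCj : coeffC K ε j ≤ (1 + K / ε) * j := by
    have : (1 : ℝ) ≤ j := by exact_mod_cast hj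
    rw [coeffC, add_mul, mul_div_assoc, mul_comm (j : ℝ)]
    linarith
  calc ‖Q.real {j} * coeffC K ε j ^ τ‖ = Q.real {j} * coeffC K ε j ^ τ :=
        Real.norm_of_nonneg (by positivity)
    _ ≤ Q.real {j} * ((1 + K / ε) * j) ^ τ := by gcongr
    _ = (1 + K / ε) ^ τ * (j ^ τ * Q.real {j}) := by
        rw [Real.mul_rpow (by positivity) (by positivity)]
        ring

theorem hasDerivAt_rateTerm (hK : 0 ≤ K) (hε : 0 < ε) (j : ℕ) (α : ℝ) :
    HasDerivAt (fun a => rateTerm Q K ε a j) (rateDerivTerm Q K ε α j) α := by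
  have hC : 0 < coeffC K ε j := one_pos.trans_le (one_le_coeffC hK hε j)
  refine ((((Real.hasStrictDerivAt_const_rpow hC α).hasDerivAt.sub_const 1).sub
    (hasDerivAt_mul_const (Real.log (coeffC K ε j)))).const_mul (Q.real {j})).congr_deriv ?_
  rw [rateDerivTerm]
  ring

/- The logarithm is absorbed by the gap between `β` and `τ`: `log C ≤ C ^ (τ - β) / (τ - β)`. -/
theorem abs_rateDerivTerm_le (hK : 0 ≤ K) (hε : 0 < ε) {β τ : ℝ} (hαβ : α ≤ β) (hβ : 0 ≤ β)
    (hβτ : β < τ) (j : ℕ) :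
    |rateDerivTerm Q K ε α j| ≤ 2 / (τ - β) * (Q.real {j} * coeffC K ε j ^ τ) := by
  have hC := one_le_coeffC hK hε j
  have hlog : Real.log (coeffC K ε j) ≤ coeffC K ε j ^ (τ - β) / (τ - β) :=
    Real.log_le_rpow_div (by linarith) (by linarith)
  have hdiff : |coeffC K ε j ^ α - 1| ≤ 2 * coeffC K ε j ^ β := by
    have h1 : 1 ≤ coeffC K ε j ^ β := Real.one_le_rpow hC hβ
    have h2 : coeffC K ε j ^ α ≤ coeffC K ε j ^ β := Real.rpow_le_rpow_of_exponent_le hC hαβ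
    have h3 : 0 < coeffC K ε j ^ α := by positivity
    exact abs_le.2 ⟨by linarith, by linarith⟩
  calc |rateDerivTerm Q K ε α j|
      = Q.real {j} * (|coeffC K ε j ^ α - 1| * Real.log (coeffC K ε j)) := by
        rw [rateDerivTerm, abs_mul, abs_mul, abs_of_nonneg (Real.log_nonneg hC),
          abs_of_nonneg measureReal_nonneg]
    _ ≤ Q.real {j} * (2 * coeffC K ε j ^ β * (coeffC K ε j ^ (τ - β) / (τ - β))) := by
        have := Real.log_nonneg hC
        gcongr
    _ = 2 / (τ - β) * (Q.real {j} * (coeffC K ε j ^ β * coeffC K ε j ^ (τ - β))) := by ring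
    _ = 2 / (τ - β) * (Q.real {j} * coeffC K ε j ^ τ) := by
        rw [← Real.rpow_add (by linarith), add_sub_cancel]

theorem exists_summable_abs_rateDerivTerm_le (hK : 0 ≤ K) (hε : 0 < ε)
    (hα : α ∈ subcriticalOrders Q) :
    ∃ β > α, 0 < β ∧ ∃ u : ℕ → ℝ, Summable u ∧ ∀ j, ∀ a < β, |rateDerivTerm Q K ε a j| ≤ u j := by
  obtain ⟨τ, h1, hατ, hs⟩ := exists_summable_rpow_of_mem hα
  have hτ : 0 < τ := one_pos.trans_le h1
  obtain ⟨β, hβ, hβτ⟩ := exists_between (max_lt hατ hτ)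
  obtain ⟨hαβ, hβ0⟩ := max_lt_iff.1 hβ
  exact ⟨β, hαβ, hβ0, _, (summable_measureReal_mul_coeffC_rpow hK hε hτ.le hs).mul_left _,
    fun j a ha => abs_rateDerivTerm_le hK hε ha.le hβ0.le hβτ j⟩

theorem summable_rateDerivTerm (hK : 0 ≤ K) (hε : 0 < ε) (hα : α ∈ subcriticalOrders Q) :
    Summable (rateDerivTerm Q K ε α) := by
  obtain ⟨β, hαβ, -, u, hu, hb⟩ := exists_summable_abs_rateDerivTerm_le hK hε hα
  exact hu.of_norm_bounded fun j => hb j α hαβ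

theorem rateTerm_zero : rateTerm Q K ε 0 = 0 := by
  ext j
  simp [rateTerm]

theorem rateI_zero : rateI lam Q K ε 0 = 0 := by
  simp [rateI, rateTerm_zero]

theorem rateDeriv_zero : rateDeriv lam Q K ε 0 = 0 := by
  simp [rateDeriv, rateDerivTerm]

theorem summable_rateTerm (hK : 0 ≤ K) (hε : 0 < ε) (hα : α ∈ subcriticalOrders Q) :
    Summable (rateTerm Q K ε α) := by
  obtain ⟨β, hαβ, hβ0, u, hu, hb⟩ := exists_summable_abs_rateDerivTerm_le hK hε hα
  exact summable_of_summable_hasDerivAt_of_isPreconnected (g := fun j a => rateTerm Q K ε a j) hu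
    isOpen_Iio isPreconnected_Iio (fun j a _ => hasDerivAt_rateTerm hK hε j a) hb
    (Set.mem_Iio.2 hβ0) (by simp only [rateTerm_zero, Pi.zero_apply, summable_zero]) hαβ

theorem hasDerivAt_rateI (hK : 0 ≤ K) (hε : 0 < ε) (hα : α ∈ subcriticalOrders Q) :
    HasDerivAt (rateI lam Q K ε) (rateDeriv lam Q K ε α) α := by
  obtain ⟨β, hαβ, hβ0, u, hu, hb⟩ := exists_summable_abs_rateDerivTerm_le hK hε hα
  exact (hasDerivAt_tsum_of_isPreconnected (g := fun j a => rateTerm Q K ε a j) hu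
    isOpen_Iio isPreconnected_Iio (fun j a _ => hasDerivAt_rateTerm hK hε j a) hb
    (Set.mem_Iio.2 hβ0) (by simp only [rateTerm_zero, Pi.zero_apply, summable_zero])
    hαβ).const_mul (lam : ℝ)

theorem exp_mul_log_coeffC (hK : 0 ≤ K) (hε : 0 < ε) (α : ℝ) (j : ℕ) :
    Real.exp (α * Real.log (coeffC K ε j)) = coeffC K ε j ^ α := by
  rw [Real.rpow_def_of_pos (one_pos.trans_le (one_le_coeffC hK hε j)), mul_comm]

theorem rateTerm_eq_exp (hK : 0 ≤ K) (hε : 0 < ε) (α : ℝ) (j : ℕ) :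
    rateTerm Q K ε α j = Q.real {j} *
      (Real.exp (α * Real.log (coeffC K ε j)) - 1 - α * Real.log (coeffC K ε j)) := by
  rw [exp_mul_log_coeffC hK hε, rateTerm]

theorem rateI_nonneg (hK : 0 ≤ K) (hε : 0 < ε) (α : ℝ) : 0 ≤ rateI lam Q K ε α := by
  refine mul_nonneg lam.2 (tsum_nonneg fun j => ?_)
  rw [rateTerm_eq_exp hK hε]
  exact mul_nonneg measureReal_nonneg (exp_sub_one_sub_nonneg _)

theorem monotone_rateDerivTerm (hK : 0 ≤ K) (hε : 0 < ε) (j : ℕ) :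
    Monotone fun a => rateDerivTerm Q K ε a j := fun a b hab => by
  have hC := one_le_coeffC hK hε j
  have := Real.log_nonneg hC
  dsimp only [rateDerivTerm]
  gcongr

theorem monotoneOn_rateDeriv (hK : 0 ≤ K) (hε : 0 < ε) :
    MonotoneOn (rateDeriv lam Q K ε) (subcriticalOrders Q) := fun _ ha _ hb hab =>
  mul_le_mul_of_nonneg_left ((summable_rateDerivTerm hK hε ha).tsum_le_tsum
    (fun j => monotone_rateDerivTerm hK hε j hab) (summable_rateDerivTerm hK hε hb)) lam.2

theorem rateDerivTerm_lt_rateDerivTerm (hK : 0 < K) (hε : 0 < ε) {j : ℕ} (hj : 0 < j)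
    (hjQ : 0 < Q.real {j}) {a b : ℝ} (hab : a < b) :
    rateDerivTerm Q K ε a j < rateDerivTerm Q K ε b j := by
  have hC : 1 < coeffC K ε j := lt_add_of_pos_right 1 (by positivity)
  have := Real.log_pos hC
  unfold rateDerivTerm
  gcongr 2
  exact sub_lt_sub_right (Real.rpow_lt_rpow_of_exponent_lt hC hab) 1

theorem exists_measureReal_singleton_pos [IsProbabilityMeasure Q] (hQ : Q {0} = 0) :
    ∃ j : ℕ, 0 < j ∧ 0 < Q.real {j} := by
  obtain ⟨j, hj⟩ := exists_measure_pos_of_not_measure_iUnion_null (μ := Q) (s := fun j : ℕ => {j})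
    (by simp [Set.iUnion_of_singleton])
  refine ⟨j, Nat.pos_of_ne_zero fun h0 => ?_, ENNReal.toReal_pos hj.ne' (measure_ne_top Q _)⟩
  exact hj.ne' (h0 ▸ hQ)

theorem strictMonoOn_rateDeriv [IsProbabilityMeasure Q] (hlam : 0 < lam) (hQ : Q {0} = 0)
    (hK : 0 < K) (hε : 0 < ε) :
    StrictMonoOn (rateDeriv lam Q K ε) (subcriticalOrders Q) := fun a ha b hb hab => by
  obtain ⟨j, hj, hjQ⟩ := exists_measureReal_singleton_pos hQ
  exact mul_lt_mul_of_pos_left ((summable_rateDerivTerm hK.le hε ha).tsum_lt_tsum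
    (fun i => monotone_rateDerivTerm hK.le hε i hab.le)
    (rateDerivTerm_lt_rateDerivTerm hK hε hj hjQ hab) (summable_rateDerivTerm hK.le hε hb)) hlam

theorem rateDerivInv_rateDeriv [IsProbabilityMeasure Q] (hlam : 0 < lam) (hQ : Q {0} = 0)
    (hK : 0 < K) (hε : 0 < ε) (h0 : 0 < α) (hα : α ∈ subcriticalOrders Q) :
    rateDerivInv lam Q K ε (rateDeriv lam Q K ε α) = ENNReal.ofReal α :=
  generalizedInv_apply_of_strictMonoOn (strictMonoOn_rateDeriv hlam hQ hK hε) h0 hα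

theorem iInf_rateI_sub_eq_neg_setLIntegral_rateDerivInv (hK : 0 ≤ K) (hε : 0 < ε)
    (h0 : 0 ∈ subcriticalOrders Q) {s₀ : ℝ} (hs₀ : 0 < s₀) :
    (⨅ (α : ℝ) (_ : 0 < α ∧ ENNReal.ofReal α < momentOrder Q),
        ((rateI lam Q K ε α - α * s₀ : ℝ) : EReal)) =
      -((∫⁻ s in Set.Ioc 0 s₀, rateDerivInv lam Q K ε s : ℝ≥0∞) : EReal) :=
  iInf_sub_mul_eq_neg_setLIntegral_generalizedInv (D := subcriticalOrders Q)
    isOpen_subcriticalOrders (fun _ ha => hasDerivAt_rateI hK hε ha) (monotoneOn_rateDeriv hK hε) h0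
    rateI_zero rateDeriv_zero hs₀

theorem integrable_exp_mul_log_coeffC [IsFiniteMeasure Q] (hK : 0 ≤ K) (hε : 0 < ε)
    (hα : α ∈ subcriticalOrders Q) :
    Integrable (fun j => Real.exp (α * Real.log (coeffC K ε j))) Q := by
  obtain ⟨τ, h1, hατ, hs⟩ := exists_summable_rpow_of_mem hα
  have hC := one_le_coeffC hK hε
  refine integrable_of_summable_measureReal_mul (Summable.of_nonneg_of_le (fun j => by positivity)
    (fun j => ?_) (summable_measureReal_mul_coeffC_rpow hK hε (zero_le_one.trans h1) hs))
  have hpos : 0 < coeffC K ε j := one_pos.trans_le (hC j)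
  rw [exp_mul_log_coeffC hK hε, abs_of_pos (Real.rpow_pos_of_pos hpos α)]
  gcongr
  exact hC j

theorem rateI_eq_mul_integral [IsFiniteMeasure Q] (hK : 0 ≤ K) (hε : 0 < ε)
    (hα : α ∈ subcriticalOrders Q) :
    rateI lam Q K ε α = lam *
      ∫ j, (Real.exp (α * Real.log (coeffC K ε j)) - 1 - α * Real.log (coeffC K ε j)) ∂Q := by
  have hs := summable_rateTerm hK hε hα
  simp only [funext (rateTerm_eq_exp (Q := Q) hK hε α)] at hs
  rw [integral_countable (integrable_of_summable_measureReal_mul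
    (by simpa only [abs_of_nonneg (exp_sub_one_sub_nonneg _)] using hs)), rateI]
  simp only [rateTerm_eq_exp hK hε, smul_eq_mul]

end RateFunction

section Tail

variable {lam : ℝ≥0} {Q : Measure ℕ} {K ε α t : ℝ} {f : ℕ → ℝ}

theorem IsLipschitzNat.nonneg (hf : IsLipschitzNat K f) : 0 ≤ K :=
  (abs_nonneg _).trans (hf 0)

theorem IsLipschitzNat.hasIncrementBound (hf : IsLipschitzNat K f) :
    HasIncrementBound (fun j : ℕ => j * K) f := fun x j => by
  induction j with
  | zero => simp
  | succ j ih =>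
    calc |f (x + (j + 1)) - f x| ≤ |f (x + j + 1) - f (x + j)| + |f (x + j) - f x| :=
          abs_sub_le _ _ _
      _ ≤ K + j * K := add_le_add (hf (x + j)) ih
      _ = (j + 1 : ℕ) * K := by push_cast; ring

theorem IsLipschitzNat.abs_le (hf : IsLipschitzNat K f) (z : ℕ) : |f z| ≤ |f 0| + z * K := by
  linarith [abs_sub_abs_le_abs_sub (f z) (f 0), hf.hasIncrementBound.abs_sub_zero_le z]

theorem IsLipschitzNat.hasIncrementBound_abs_sub (hf : IsLipschitzNat K f) (m : ℝ) :
    HasIncrementBound (fun j : ℕ => j * K) fun z => |f z - m| :=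
  HasIncrementBound.abs fun x y => by simpa using hf.hasIncrementBound x y

theorem abs_log_sub_log_le {δ a b : ℝ} (hδ : 0 < δ) (ha : δ ≤ a) (hb : δ ≤ b) :
    |Real.log b - Real.log a| ≤ Real.log (1 + |b - a| / δ) := by
  have hlog : ∀ {u v : ℝ}, δ ≤ u → δ ≤ v →
      Real.log v - Real.log u ≤ Real.log (1 + |v - u| / δ) := fun {u v} hu hv => by
    have hu0 : 0 < u := hδ.trans_le hu
    have hratio : v / u ≤ 1 + |v - u| / δ := calc
      v / u = 1 + (v - u) / u := by field_simp; ring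
      _ ≤ 1 + |v - u| / δ := by gcongr; exact le_abs_self _
    rw [← Real.log_div (hδ.trans_le hv).ne' hu0.ne']
    exact Real.log_le_log (div_pos (hδ.trans_le hv) hu0) hratio
  exact abs_sub_le_iff.2 ⟨hlog ha hb, abs_sub_comm b a ▸ hlog hb ha⟩

theorem IsLipschitzNat.hasIncrementBound_log (hf : IsLipschitzNat K f) (hε : 0 < ε) (hα : 0 ≤ α)
    (m : ℝ) : HasIncrementBound (fun j => α * Real.log (coeffC K ε j))
      fun z => α * Real.log (|f z - m| + ε) := fun x j => by
  have hle : ∀ z, ε ≤ |f z - m| + ε := fun z => le_add_of_nonneg_left (abs_nonneg _)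
  have hinc := hf.hasIncrementBound_abs_sub m x j
  rw [← mul_sub, abs_mul, abs_of_nonneg hα]
  refine mul_le_mul_of_nonneg_left ((abs_log_sub_log_le hε (hle x) (hle _)).trans ?_) hα
  rw [coeffC, add_sub_add_right_eq_sub]
  gcongr

theorem coeffC_zero : coeffC K ε 0 = 1 := by
  simp [coeffC]

theorem log_coeffC_add_le (hK : 0 ≤ K) (hε : 0 < ε) (x y : ℕ) :
    Real.log (coeffC K ε (x + y)) ≤ Real.log (coeffC K ε x) + Real.log (coeffC K ε y) := by
  have hpos : ∀ j, 0 < coeffC K ε j := fun j => one_pos.trans_le (one_le_coeffC hK hε j)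
  rw [← Real.log_mul (hpos x).ne' (hpos y).ne']
  refine Real.log_le_log (hpos _) ?_
  have hxy : 0 ≤ x * K / ε * (y * K / ε) := by positivity
  simp only [coeffC, Nat.cast_add]
  linarith [show (x + y) * K / ε = x * K / ε + y * K / ε by ring]

theorem threshold_pos (hK : 0 ≤ K) (hε : 0 < ε) (y : ℝ) : 0 < threshold lam Q K ε y := by
  have hq := firstMoment_nonneg (Q := Q)
  rw [threshold]
  positivity

theorem integral_log_le_log_integral {X : Type*} [MeasurableSpace X] {μ : Measure X}
    [IsProbabilityMeasure μ] {G : X → ℝ} {δ : ℝ} (hδ : 0 < δ) (hG : ∀ x, δ ≤ G x)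
    (hi : Integrable G μ) (hlog : Integrable (fun x => Real.log (G x)) μ) :
    ∫ x, Real.log (G x) ∂μ ≤ Real.log (∫ x, G x ∂μ) := by
  have hsub : Set.Ici δ ⊆ Set.Ioi 0 := Set.Ici_subset_Ioi.2 hδ
  exact (strictConcaveOn_log_Ioi.concaveOn.subset hsub (convex_Ici δ)).le_map_integral
    (Real.continuousOn_log.mono fun x hx => (hsub hx).ne') isClosed_Ici (.of_forall hG) hi hlog

theorem HasExpMomentBound.measure_ge_le {M : Type*} [AddCommMonoid M] [MeasurableSpace M]
    {μ : Measure M} [IsFiniteMeasure μ] {c h : M → ℝ} {R : ℝ}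
    (hR : HasExpMomentBound μ c R) (hh : HasIncrementBound c h)
    (hexp : Integrable (fun x => Real.exp (h x)) μ) (b : ℝ) :
    μ {x | b ≤ h x} ≤ ENNReal.ofReal (Real.exp (∫ x, h x ∂μ + R - b)) := by
  rw [← ofReal_measureReal]
  refine ENNReal.ofReal_le_ofReal ?_
  calc μ.real {x | b ≤ h x} ≤ Real.exp (-1 * b) * mgf h μ 1 :=
        measure_ge_le_exp_mul_mgf b zero_le_one (by simpa only [one_mul] using hexp)
    _ ≤ Real.exp (-1 * b) * Real.exp (∫ x, h x ∂μ + R) := by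
        simp only [mgf, one_mul]
        gcongr
        exact hR h hh
    _ = Real.exp (∫ x, h x ∂μ + R - b) := by
        rw [← Real.exp_add]
        ring_nf

variable [IsProbabilityMeasure Q]

theorem IsLipschitzNat.integrable (hs : Summable fun j : ℕ => (j : ℝ) * Q.real {j})
    (hf : IsLipschitzNat K f) : Integrable f (compoundPoisson lam Q) :=
  ((integrable_const |f 0|).add ((integrable_natCast_compoundPoisson hs).mul_const K)).mono'
    .of_discrete (.of_forall hf.abs_le)

theorem IsLipschitzNat.integral_abs_le (hs : Summable fun j : ℕ => (j : ℝ) * Q.real {j})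
    (hf : IsLipschitzNat K f) :
    ∫ z, |f z| ∂(compoundPoisson lam Q) ≤ |f 0| + K * lam * firstMoment Q := by
  have hi := integrable_natCast_compoundPoisson (lam := lam) hs
  calc ∫ z, |f z| ∂(compoundPoisson lam Q)
      ≤ ∫ z : ℕ, (|f 0| + z * K) ∂(compoundPoisson lam Q) :=
        integral_mono (hf.integrable hs).abs ((integrable_const _).add (hi.mul_const K)) hf.abs_le
    _ = |f 0| + K * lam * firstMoment Q := by
        rw [integral_add (integrable_const _) (hi.mul_const K), integral_mul_const,
          integral_natCast_compoundPoisson hs]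
        simp only [integral_const, probReal_univ, one_smul]
        ring

theorem IsLipschitzNat.integral_abs_sub_add_le (hs : Summable fun j : ℕ => (j : ℝ) * Q.real {j})
    (hf : IsLipschitzNat K f) (ε : ℝ) :
    ∫ z, (|f z - ∫ y, f y ∂(compoundPoisson lam Q)| + ε) ∂(compoundPoisson lam Q) ≤
      threshold lam Q K ε (f 0) := by
  have hi := hf.integrable (lam := lam) hs
  have hb := hf.integral_abs_le (lam := lam) hs
  set μ := compoundPoisson lam Q
  have hm : |∫ y, f y ∂μ| ≤ ∫ y, |f y| ∂μ := abs_integral_le_integral_abs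
  calc ∫ z, (|f z - ∫ y, f y ∂μ| + ε) ∂μ ≤ ∫ z, (|f z| + (|∫ y, f y ∂μ| + ε)) ∂μ := by
        refine integral_mono ((hi.sub (integrable_const _)).abs.add (integrable_const _))
          (hi.abs.add (integrable_const _)) fun z => ?_
        linarith [abs_sub (f z) (∫ y, f y ∂μ)]
    _ = ∫ z, |f z| ∂μ + (|∫ y, f y ∂μ| + ε) := by
        rw [integral_add hi.abs (integrable_const _), integral_const, probReal_univ, one_smul]
    _ ≤ threshold lam Q K ε (f 0) := by
        rw [threshold]
        linarith

theorem mul_log_coeffC_add_le (hK : 0 ≤ K) (hε : 0 < ε) (hα : 0 ≤ α) (x y : ℕ) :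
    α * Real.log (coeffC K ε (x + y)) ≤
      α * Real.log (coeffC K ε x) + α * Real.log (coeffC K ε y) := by
  rw [← mul_add]
  exact mul_le_mul_of_nonneg_left (log_coeffC_add_le hK hε x y) hα

theorem hasExpMomentBound_mul_log_coeffC (hK : 0 ≤ K) (hε : 0 < ε) (hα0 : 0 ≤ α)
    (hα : α ∈ subcriticalOrders Q) :
    HasExpMomentBound (compoundPoisson lam Q) (fun j => α * Real.log (coeffC K ε j))
      (rateI lam Q K ε α) := by
  rw [rateI_eq_mul_integral hK hε hα]
  exact hasExpMomentBound_compoundPoisson (by simp [coeffC_zero])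
    (mul_log_coeffC_add_le hK hε hα0) (integrable_exp_mul_log_coeffC hK hε hα)

theorem IsLipschitzNat.integral_mul_log_le (hf : IsLipschitzNat K f)
    (hs : Summable fun j : ℕ => (j : ℝ) * Q.real {j}) (hε : 0 < ε) (hα : 0 ≤ α)
    (hi : Integrable
      (fun z => α * Real.log (|f z - ∫ y, f y ∂(compoundPoisson lam Q)| + ε))
      (compoundPoisson lam Q)) :
    ∫ z, α * Real.log (|f z - ∫ y, f y ∂(compoundPoisson lam Q)| + ε)
      ∂(compoundPoisson lam Q) ≤ α * Real.log (threshold lam Q K ε (f 0)) := by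
  have hT := hf.integral_abs_sub_add_le (lam := lam) hs ε
  have hfi := hf.integrable (lam := lam) hs
  set μ := compoundPoisson lam Q
  set G : ℕ → ℝ := fun z => |f z - ∫ y, f y ∂μ| + ε
  have hGε : ∀ z, ε ≤ G z := fun z => le_add_of_nonneg_left (abs_nonneg _)
  have hGi : Integrable G μ := (hfi.sub (integrable_const _)).abs.add (integrable_const _)
  rcases hα.eq_or_lt with rfl | hα
  · simp
  have hlog : Integrable (fun z => Real.log (G z)) μ :=
    (integrable_const_mul_iff (IsUnit.mk0 α hα.ne') _).1 hi
  have hε' : ε ≤ ∫ z, G z ∂μ := by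
    simpa using integral_mono (integrable_const ε) hGi hGε
  rw [integral_const_mul]
  gcongr
  exact (integral_log_le_log_integral hε hGε hGi hlog).trans
    (Real.log_le_log (hε.trans_le hε') hT)

theorem IsLipschitzNat.compoundPoisson_tail_le (hf : IsLipschitzNat K f)
    (h1 : 1 ∈ subcriticalOrders Q) (ht : 0 < t) (hε : 0 < ε) (hα0 : 0 ≤ α)
    (hα : α ∈ subcriticalOrders Q) :
    compoundPoisson lam Q {z | t < |f z - ∫ y, f y ∂(compoundPoisson lam Q)|} ≤
      ENNReal.ofReal (Real.exp
        (rateI lam Q K ε α + α * Real.log (threshold lam Q K ε (f 0) / t))) := by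
  have hK := hf.nonneg
  have hexp := integrable_exp_compoundPoisson (lam := lam) (by simp [coeffC_zero])
    (mul_log_coeffC_add_le hK hε hα0) (integrable_exp_mul_log_coeffC hK hε hα)
  have hinc := hf.hasIncrementBound_log hε hα0 (∫ y, f y ∂(compoundPoisson lam Q))
  have hmean := hf.integral_mul_log_le (summable_natCast_mul_measureReal h1) hε hα0
    (hinc.integrable hexp)
  calc compoundPoisson lam Q {z | t < |f z - ∫ y, f y ∂(compoundPoisson lam Q)|}
      ≤ compoundPoisson lam Q {z | α * Real.log t ≤
          α * Real.log (|f z - ∫ y, f y ∂(compoundPoisson lam Q)| + ε)} := by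
        refine measure_mono fun z hz => mul_le_mul_of_nonneg_left (Real.log_le_log ht ?_) hα0
        exact (le_of_lt hz).trans (le_add_of_nonneg_right hε.le)
    _ ≤ _ := (hasExpMomentBound_mul_log_coeffC hK hε hα0 hα).measure_ge_le hinc
        (hinc.integrable_exp hexp) _
    _ ≤ _ := by
        refine ENNReal.ofReal_le_ofReal (Real.exp_le_exp.2 ?_)
        rw [Real.log_div (threshold_pos hK hε _).ne' ht.ne']
        linarith

end Tail

section PowerBound

variable {lam : ℝ≥0} {Q : Measure ℕ} {K ε α t y : ℝ}

theorem le_exp_iInf {ι : Type*} {p : ι → Prop} {g : ι → ℝ} {x : ℝ≥0∞}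
    (h : ∀ i, p i → x ≤ ENNReal.ofReal (Real.exp (g i))) :
    x ≤ EReal.exp (⨅ (i) (_ : p i), (g i : EReal)) := by
  rw [← ENNReal.exp_log x, EReal.exp_le_exp_iff]
  refine le_iInf₂ fun i hi => ?_
  rw [← EReal.exp_le_exp_iff, ENNReal.exp_log]
  exact h i hi

theorem IsLipschitzNat.compoundPoisson_tail_le_powerBound [IsProbabilityMeasure Q] {f : ℕ → ℝ}
    (hf : IsLipschitzNat K f) (h1 : 1 ∈ subcriticalOrders Q) (ht : 0 < t) (hε : 0 < ε) :
    compoundPoisson lam Q {z | t < |f z - ∫ y, f y ∂(compoundPoisson lam Q)|} ≤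
      powerBound lam Q K ε (f 0) t :=
  le_exp_iInf fun _ hα => hf.compoundPoisson_tail_le h1 ht hε hα.1.le hα.2

theorem powerBound_lt_one_iff (hK : 0 ≤ K) (hε : 0 < ε) (h0 : 0 ∈ subcriticalOrders Q)
    (ht : 0 < t) : powerBound lam Q K ε y t < 1 ↔ threshold lam Q K ε y < t := by
  have hT : 0 < threshold lam Q K ε y := threshold_pos hK hε y
  rw [powerBound, EReal.exp_lt_one_iff]
  constructor
  · contrapose!
    intro hle
    have hlog : 0 ≤ Real.log (threshold lam Q K ε y / t) := Real.log_nonneg ((one_le_div ht).2 hle)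
    exact le_iInf₂ fun α hα => EReal.coe_nonneg.2
      (add_nonneg (rateI_nonneg hK hε α) (mul_nonneg hα.1.le hlog))
  · intro hlt
    have hderiv : HasDerivAt (rateI lam Q K ε) 0 0 := by
      simpa only [rateDeriv_zero] using hasDerivAt_rateI (lam := lam) hK hε h0
    obtain ⟨α, hα, hneg⟩ := exists_lt_mul_of_hasDerivAt_zero isOpen_subcriticalOrders h0 hderiv
      rateI_zero (Real.log_pos ((one_lt_div hT).2 hlt))
    refine (iInf₂_le α hα).trans_lt (EReal.coe_neg'.2 ?_)
    rw [← inv_div, Real.log_inv]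
    linarith

theorem powerBound_eq_integralBound (hK : 0 ≤ K) (hε : 0 < ε) (h0 : 0 ∈ subcriticalOrders Q)
    (ht : threshold lam Q K ε y < t) :
    powerBound lam Q K ε y t = integralBound lam Q K ε y t := by
  have hlog : 0 < Real.log (t / threshold lam Q K ε y) :=
    Real.log_pos ((one_lt_div (threshold_pos hK hε y)).2 ht)
  rw [powerBound, integralBound, ← iInf_rateI_sub_eq_neg_setLIntegral_rateDerivInv hK hε h0 hlog,
    ← inv_div, Real.log_inv]
  simp only [mul_neg, sub_eq_add_neg]

end PowerBound

theorem theorem3 {Ω : Type*} [MeasurableSpace Ω] (P : Measure Ω)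
    (lam : ℝ≥0) (hlam : 0 < lam)
    (Q : Measure ℕ) [IsProbabilityMeasure Q] (hQ : Q {0} = 0)
    (hL : 1 < momentOrder Q)
    (Z : Ω → ℕ) (hZ : HasLaw Z (compoundPoisson lam Q) P)
    (K : ℝ) (f : ℕ → ℝ) (hf : IsLipschitzNat K f)
    (t ε : ℝ) (ht : 0 < t) (hε : 0 < ε) :
    -- the quantities in the statement are well defined
    (Summable (fun j : ℕ => (j : ℝ) * Q.real {j}) ∧
      Integrable (fun ω => f (Z ω)) P ∧
      ∀ α : ℝ, 0 < α → ENNReal.ofReal α < momentOrder Q →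
        Summable (rateTerm Q K ε α)) ∧
    -- the power-law bound
    P {ω | t < |f (Z ω) - ∫ ω', f (Z ω') ∂P|} ≤ powerBound lam Q K ε (f 0) t ∧
    -- the bound is less than 1 exactly when t > T
    (powerBound lam Q K ε (f 0) t < 1 ↔ threshold lam Q K ε (f 0) < t) ∧
    -- the function i is the derivative of I, and its inverse is the ordinary one
    (∀ α : ℝ, 0 < α → ENNReal.ofReal α < momentOrder Q →
      Summable (rateDerivTerm Q K ε α) ∧
      HasDerivAt (rateI lam Q K ε) (rateDeriv lam Q K ε α) α ∧
      (0 < K → rateDerivInv lam Q K ε (rateDeriv lam Q K ε α) = ENNReal.ofReal α)) ∧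
    -- the integral form of the bound
    (threshold lam Q K ε (f 0) < t →
      powerBound lam Q K ε (f 0) t = integralBound lam Q K ε (f 0) t ∧
      P {ω | t < |f (Z ω) - ∫ ω', f (Z ω') ∂P|} ≤ integralBound lam Q K ε (f 0) t) := by
  have hK := hf.nonneg
  have h1 : (1 : ℝ) ∈ subcriticalOrders Q := ENNReal.ofReal_one.trans_lt hL
  have h0 : (0 : ℝ) ∈ subcriticalOrders Q := subcriticalOrders_mem_of_le h1 zero_le_one
  have hs := summable_natCast_mul_measureReal h1
  have hint : Integrable (fun ω => f (Z ω)) P :=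
    (hZ.map_eq ▸ hf.integrable hs : Integrable f (P.map Z)).comp_aemeasurable hZ.aemeasurable
  have htail : P {ω | t < |f (Z ω) - ∫ ω', f (Z ω') ∂P|} ≤ powerBound lam Q K ε (f 0) t := by
    rw [show ∫ ω, f (Z ω) ∂P = ∫ z, f z ∂(compoundPoisson lam Q) from
        hZ.integral_comp (f := f) .of_discrete,
      hZ.measure_eq (p := fun z => t < |f z - ∫ z, f z ∂(compoundPoisson lam Q)|) .of_discrete]
    exact hf.compoundPoisson_tail_le_powerBound h1 ht hε
  refine ⟨⟨hs, hint, fun _ _ hα => summable_rateTerm hK hε hα⟩, htail,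
    powerBound_lt_one_iff hK hε h0 ht, fun _ hα0 hα => ⟨summable_rateDerivTerm hK hε hα,
      hasDerivAt_rateI hK hε hα, fun hK' => rateDerivInv_rateDeriv hlam hQ hK' hε hα0 hα⟩,
    fun hT => ?_⟩
  rw [← powerBound_eq_integralBound hK hε h0 hT]
  exact ⟨rfl, htail⟩
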